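/- All graphs are finite, simple and undirected, and are counted up to isomorphism. For a graph $G$ let $\chi(G)$ denote its chromatic number, and for a vertex $v$ of $G$ let $G-v$ be the graph obtained by deleting $v$. A graph $G$ is \emph{$k$-vertex-critical} if $\chi(G)=k$ and $\chi(G-v)<k$ for every vertex $v$ of $G$; it is \emph{$H$-free} if it has no induced subgraph isomorphic to $H$. Let $\overline{K_4}$ be the graph with four vertices and no edges, let $P_t$ be the path on $t$ vertices, and let $+$ denote disjoint union, with $2P_1=P_1+P_1$. Let $H$ be a graph with at most four vertices, and let $k\ge 5$ be an integer. Then there are only finitely many $k$-vertex-critical $H$-free graphs if and only if $H$ is isomorphic to an induced subgraph of at least one of $\overline{K_4}$, $P_4$, $P_2+2P_1$, $P_3+P_1$. -/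

import Mathlib

open scoped SimpleGraph

/-- `G` is `k`-vertex-critical: `χ(G) = k`, and `χ(G - v) < k` for every vertex `v`. -/
def IsVertexCritical {V : Type*} (G : SimpleGraph V) (k : ℕ) : Prop :=
  G.chromaticNumber = (k : ℕ∞) ∧ ∀ v : V, (G.induce {v}ᶜ).chromaticNumber < (k : ℕ∞)

/-- `G` is `H`-free: it does not contain `H` as an induced subgraph. -/
def IsInducedFree {V W : Type*} (H : SimpleGraph V) (G : SimpleGraph W) : Prop :=
  ¬ H ⊴ G

/-- Finite simple graphs on the vertex sets `{0, …, n - 1}`, identified when isomorphic. -/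
def graphIsoSetoid : Setoid (Σ n : ℕ, SimpleGraph (Fin n)) where
  r G G' := Nonempty (G.2 ≃g G'.2)
  iseqv :=
    { refl := fun _ => ⟨SimpleGraph.Iso.refl⟩
      symm := fun ⟨f⟩ => ⟨f.symm⟩
      trans := fun ⟨f⟩ ⟨g⟩ => ⟨g.comp f⟩ }

/-- The isomorphism classes of finite simple graphs. -/
def GraphIsoClass : Type := Quotient graphIsoSetoid

/-- The isomorphism class of a graph on `{0, …, n - 1}`. -/
def graphIsoClass {n : ℕ} (G : SimpleGraph (Fin n)) : GraphIsoClass :=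
  Quotient.mk graphIsoSetoid ⟨n, G⟩

/-- The isomorphism classes of the finite `k`-vertex-critical `H`-free graphs. -/
def criticalFreeClasses {V : Type*} (k : ℕ) (H : SimpleGraph V) : Set GraphIsoClass :=
  {c | ∃ (n : ℕ) (G : SimpleGraph (Fin n)),
    IsVertexCritical G k ∧ IsInducedFree H G ∧ graphIsoClass G = c}

/-! Write k = m + 1. Finiteness follows from a bound on the order of T-free critical graphs for each
of the four maximal graphs T. For 4P₁, P₂ + 2P₁ and P₃ + P₁ the independence number is bounded, and
the order is at most that bound times the number of colours (`card_le_of_independent_card_le`). For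
the last two, too large an independent set would let an m-colouring of some G - v be turned into one
of G. A P₄-free graph has chromatic number equal to its clique number, so a critical one is
complete.

Conversely, a graph on at most four vertices contained in none of the four has a triangle, an
induced C₄, an induced claw or an induced 2P₂ (`classification_card_le_four`). Arbitrarily large
critical graphs avoid each of these: iterated Mycielskians of odd cycles have no triangle, powers of
cycles on mp + 1 vertices have no induced C₄ (for p ≥ 4) and no induced claw, and a denser circulant
`twoEdgesFreeGraph` has no induced 2P₂. The circulants are critical by the single criterion
`isVertexCritical_of_cyclic`. Only the 2P₂ case needs k ≥ 5. -/

/-- `G` restricted to the vertex set `s` has a proper colouring with colours `0, …, m - 1`. -/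
def ColorableOn {V : Type*} (G : SimpleGraph V) (s : Set V) (m : ℕ) : Prop :=
  ∃ c : V → ℕ, (∀ a ∈ s, c a < m) ∧ ∀ a ∈ s, ∀ b ∈ s, G.Adj a b → c a ≠ c b

lemma colorableOn_iff_colorable_induce {V : Type*} (G : SimpleGraph V) (s : Set V) (m : ℕ) :
    ColorableOn G s m ↔ (G.induce s).Colorable m := by
  classical
  rw [SimpleGraph.colorable_iff_exists_bdd_nat_coloring]
  constructor
  · rintro ⟨c, hc, hadj⟩
    exact ⟨SimpleGraph.Coloring.mk (fun x => c x) fun {x y} h => hadj x x.2 y y.2 h,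
      fun x => hc x x.2⟩
  · rintro ⟨C, hC⟩
    refine ⟨fun x => if h : x ∈ s then C ⟨x, h⟩ else 0, fun a ha => ?_, fun a ha b hb hab => ?_⟩
    · simpa [ha] using hC ⟨a, ha⟩
    · simpa [ha, hb] using C.valid (v := ⟨a, ha⟩) (w := ⟨b, hb⟩) hab

lemma colorableOn_univ_iff {V : Type*} (G : SimpleGraph V) (m : ℕ) :
    ColorableOn G Set.univ m ↔ G.Colorable m := by
  rw [SimpleGraph.colorable_iff_exists_bdd_nat_coloring]
  constructor
  · rintro ⟨c, hc, hadj⟩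
    exact ⟨SimpleGraph.Coloring.mk c fun {x y} h => hadj x trivial y trivial h,
      fun x => hc x trivial⟩
  · rintro ⟨C, hC⟩
    exact ⟨C, fun a _ => hC a, fun a _ b _ hab => C.valid hab⟩

lemma ColorableOn.univ_succ {V : Type*} {G : SimpleGraph V} {v : V} {m : ℕ}
    (h : ColorableOn G {v}ᶜ m) : ColorableOn G Set.univ (m + 1) := by
  classical
  obtain ⟨c, hc, hadj⟩ := h
  have hc' : ∀ a, a ≠ v → c a < m := fun a ha => hc a ha
  have hadj' : ∀ a b, a ≠ v → b ≠ v → G.Adj a b → c a ≠ c b := fun a b ha hb => hadj a ha b hb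
  refine ⟨fun x => if x = v then m else c x, fun a _ => ?_, fun a _ b _ hab => ?_⟩
  · grind
  · have := hab.ne
    grind

/-- The working form of criticality: every later argument manipulates colour functions `V → ℕ`
instead of chromatic numbers of induced subgraphs. -/
lemma isVertexCritical_succ_iff {V : Type*} (G : SimpleGraph V) (m : ℕ) :
    IsVertexCritical G (m + 1) ↔
      ColorableOn G Set.univ (m + 1) ∧ ¬ ColorableOn G Set.univ m ∧
        ∀ v, ColorableOn G {v}ᶜ m := by
  unfold IsVertexCritical
  push_cast
  rw [SimpleGraph.chromaticNumber_eq_iff_colorable_not_colorable, colorableOn_univ_iff,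
    colorableOn_univ_iff, and_assoc]
  refine and_congr_right fun _ => and_congr_right fun _ => forall_congr' fun v => ?_
  rw [colorableOn_iff_colorable_induce, ← SimpleGraph.chromaticNumber_le_iff_colorable,
    ENat.lt_add_one_iff (ENat.natCast_ne_top m)]

lemma ColorableOn.of_iso {V W : Type*} {G : SimpleGraph V} {G' : SimpleGraph W} (e : G ≃g G')
    {s : Set V} {m : ℕ} (h : ColorableOn G s m) : ColorableOn G' (e.symm ⁻¹' s) m := by
  obtain ⟨c, hc, hadj⟩ := h
  exact ⟨fun x => c (e.symm x), fun a ha => hc _ ha,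
    fun a ha b hb hab => hadj _ ha _ hb (e.symm.map_adj_iff.2 hab)⟩

lemma IsVertexCritical.of_iso {V W : Type*} {G : SimpleGraph V} {G' : SimpleGraph W}
    (e : G ≃g G') {m : ℕ} (h : IsVertexCritical G (m + 1)) : IsVertexCritical G' (m + 1) := by
  rw [isVertexCritical_succ_iff] at h ⊢
  refine ⟨h.1.of_iso e, fun h' => h.2.1 (h'.of_iso e.symm), fun v => ?_⟩
  have := (h.2.2 (e.symm v)).of_iso e
  have hs : (e.symm ⁻¹' {e.symm v}ᶜ : Set W) = {v}ᶜ := by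
    ext x; simp
  rwa [hs] at this

lemma IsInducedFree.mono {U V W : Type*} {H : SimpleGraph U} {T : SimpleGraph V}
    {G : SimpleGraph W} (hHT : H ⊴ T) (h : IsInducedFree H G) : IsInducedFree T G :=
  fun hT => h (hHT.trans hT)

/-- A bound on the order of the `k`-vertex-critical `T`-free graphs makes the number of
`k`-vertex-critical `H`-free graphs finite for every induced subgraph `H` of `T`. -/
lemma finite_criticalFreeClasses_of_bound {U V : Type*} {H : SimpleGraph U} {T : SimpleGraph V}
    (hHT : H ⊴ T) {k : ℕ} (N : ℕ)
    (hN : ∀ (n : ℕ) (G : SimpleGraph (Fin n)), IsVertexCritical G k → IsInducedFree T G → n ≤ N) :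
    (criticalFreeClasses k H).Finite := by
  refine (Set.finite_range
    (fun x : Σ n : Fin (N + 1), SimpleGraph (Fin n) => graphIsoClass x.2)).subset ?_
  rintro _ ⟨n, G, hG, hfree, rfl⟩
  exact ⟨⟨⟨n, Nat.lt_succ_of_le (hN n G hG (hfree.mono hHT))⟩, G⟩, rfl⟩

/-- The number of vertices of an isomorphism class. -/
def GraphIsoClass.order : GraphIsoClass → ℕ :=
  Quotient.lift (fun x : Σ n : ℕ, SimpleGraph (Fin n) => x.1) fun _ _ ⟨e⟩ => by
    simpa using Fintype.card_congr e.toEquiv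

lemma criticalFreeClasses_infinite {U : Type*} {H : SimpleGraph U} {m : ℕ}
    (h : ∀ N : ℕ, ∃ (V : Type) (_ : Fintype V) (G : SimpleGraph V),
      N < Fintype.card V ∧ IsVertexCritical G (m + 1) ∧ IsInducedFree H G) :
    ¬ (criticalFreeClasses (m + 1) H).Finite := by
  intro hfin
  obtain ⟨N, hN⟩ := (hfin.image GraphIsoClass.order).bddAbove
  obtain ⟨V, _, G, hcard, hG, hfree⟩ := h N
  let e : G ≃g G.overFin rfl := G.overFinIso rfl
  have : Fintype.card V ≤ N := hN ⟨graphIsoClass (G.overFin rfl),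
    ⟨_, _, hG.of_iso e, fun hH => hfree (hH.trans e.isIndContained'), rfl⟩, rfl⟩
  omega

/-! ### Induced copies of P₄, P₂ + 2P₁ and P₃ + P₁ from adjacency data. -/

section Patterns

variable {V : Type*} {G : SimpleGraph V} {a b c d : V}

lemma pathGraph_four_isIndContained (hab : G.Adj a b) (hbc : G.Adj b c) (hcd : G.Adj c d)
    (nac : ¬ G.Adj a c) (nad : ¬ G.Adj a d) (nbd : ¬ G.Adj b d) :
    SimpleGraph.pathGraph 4 ⊴ G := by
  have h1 : a ≠ c := by rintro rfl; exact nad hcd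
  have h2 : b ≠ d := by rintro rfl; exact nad hab
  have h3 : a ≠ d := by rintro rfl; exact nbd hab.symm
  have := hab.ne
  have := hbc.ne
  have := hcd.ne
  refine ⟨⟨⟨![a, b, c, d], ?_⟩, ?_⟩⟩
  · intro i j; fin_cases i <;> fin_cases j <;> simp_all [eq_comm]
  · intro i j
    change G.Adj (![a, b, c, d] i) (![a, b, c, d] j) ↔ _
    fin_cases i <;> fin_cases j <;> simp_all [SimpleGraph.pathGraph_adj, G.adj_comm]

lemma coDiamond_isIndContained (hab : G.Adj a b) (hcd : c ≠ d) (nac : ¬ G.Adj a c)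
    (nad : ¬ G.Adj a d) (nbc : ¬ G.Adj b c) (nbd : ¬ G.Adj b d) (ncd : ¬ G.Adj c d) :
    (SimpleGraph.pathGraph 2 ⊕g (SimpleGraph.pathGraph 1 ⊕g SimpleGraph.pathGraph 1)) ⊴ G := by
  have h1 : a ≠ c := by rintro rfl; exact nbc hab.symm
  have h2 : b ≠ d := by rintro rfl; exact nad hab
  have h3 : a ≠ d := by rintro rfl; exact nbd hab.symm
  have h4 : b ≠ c := by rintro rfl; exact nac hab
  have := hab.ne
  refine ⟨⟨⟨Sum.elim ![a, b] (Sum.elim ![c] ![d]), ?_⟩, ?_⟩⟩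
  · rintro (i | i | i) (j | j | j) <;> fin_cases i <;> fin_cases j <;> simp_all [eq_comm]
  · intro i j
    change G.Adj (Sum.elim ![a, b] (Sum.elim ![c] ![d]) i)
      (Sum.elim ![a, b] (Sum.elim ![c] ![d]) j) ↔ _
    revert i j
    rintro (i | i | i) (j | j | j) <;> fin_cases i <;> fin_cases j <;>
      simp_all [SimpleGraph.pathGraph_adj, G.adj_comm]

lemma coPaw_isIndContained (hab : G.Adj a b) (hbc : G.Adj b c) (hac : a ≠ c) (nac : ¬ G.Adj a c)
    (nad : ¬ G.Adj a d) (nbd : ¬ G.Adj b d) (ncd : ¬ G.Adj c d) :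
    (SimpleGraph.pathGraph 3 ⊕g SimpleGraph.pathGraph 1) ⊴ G := by
  have h1 : a ≠ d := by rintro rfl; exact nbd hab.symm
  have h2 : b ≠ d := by rintro rfl; exact nad hab
  have h3 : c ≠ d := by rintro rfl; exact nbd hbc
  have := hab.ne
  have := hbc.ne
  refine ⟨⟨⟨Sum.elim ![a, b, c] ![d], ?_⟩, ?_⟩⟩
  · rintro (i | i) (j | j) <;> fin_cases i <;> fin_cases j <;> simp_all [eq_comm]
  · intro i j
    change G.Adj (Sum.elim ![a, b, c] ![d] i)
      (Sum.elim ![a, b, c] ![d] j) ↔ _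
    revert i j
    rintro (i | i) (j | j) <;> fin_cases i <;> fin_cases j <;>
      simp_all [SimpleGraph.pathGraph_adj, G.adj_comm]

end Patterns

/-- In a `P₄`-free graph, a maximal clique meets every maximal independent set. -/
lemma not_disjoint_of_pathGraph_four_free {V : Type*} {G : SimpleGraph V}
    (hfree : IsInducedFree (SimpleGraph.pathGraph 4) G) {t S : Finset V}
    (ht : ∀ a ∈ t, ∀ b ∈ t, a ≠ b → G.Adj a b)
    (hS : ∀ a ∈ S, ∀ b ∈ S, ¬ G.Adj a b) (hne : S.Nonempty)
    (htmax : ∀ v ∈ S, ∃ u ∈ t, ¬ G.Adj v u) (hSmax : ∀ v ∈ t, ∃ u ∈ S, G.Adj v u) : False := by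
  classical
  -- Take `s` in `S` with the most neighbours in `t`, a nonneighbour `v` of `s` in `t`, and a
  -- neighbour `r` of `v` in `S`. Maximality gives `u` in `t` adjacent to `s` but not to `r`, and s,
  -- u, v, r is an induced path.
  obtain ⟨s, hs, hmax⟩ := Finset.exists_max_image S (fun s => (t.filter (G.Adj s)).card) hne
  obtain ⟨v, hv, hsv⟩ := htmax s hs
  obtain ⟨r, hr, hvr⟩ := hSmax v hv
  have hsub : ¬ t.filter (G.Adj s) ⊆ t.filter (G.Adj r) := by
    intro hsub
    have hlt : t.filter (G.Adj s) ⊂ t.filter (G.Adj r) := Finset.ssubset_iff_of_subset hsub |>.2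
      ⟨v, by simp [hv, hvr.symm], by simp [hsv]⟩
    exact absurd (hmax r hr) (not_le.2 (Finset.card_lt_card hlt))
  obtain ⟨u, hu, hu'⟩ := Finset.not_subset.1 hsub
  simp only [Finset.mem_filter, not_and] at hu hu'
  exact hfree (pathGraph_four_isIndContained hu.2
    (ht u hu.1 v hv (by rintro rfl; exact hsv hu.2)) hvr hsv (hS s hs r hr)
    (fun h => hu' hu.1 h.symm))

/-! ### Bounds on the order of critical graphs avoiding one of the four maximal graphs. -/

section FiniteDirection

variable {V : Type*} [Fintype V] {G : SimpleGraph V} {m : ℕ}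

lemma card_le_of_independent_card_le {α : ℕ} (hG : IsVertexCritical G (m + 1))
    (hα : ∀ s : Finset V, (∀ a ∈ s, ∀ b ∈ s, ¬ G.Adj a b) → s.card ≤ α) :
    Fintype.card V ≤ α * (m + 1) := by
  classical
  obtain ⟨⟨c, hc, hadj⟩, -, -⟩ := (isVertexCritical_succ_iff G m).1 hG
  have := Finset.card_le_mul_card_image_of_maps_to (s := Finset.univ) (t := Finset.range (m + 1))
    (f := c) (fun a _ => Finset.mem_range.2 (hc a trivial)) α (fun i _ => hα _ (by
      intro a ha b hb hab
      simp only [Finset.mem_filter] at ha hb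
      exact hadj a trivial b trivial hab (ha.2.trans hb.2.symm)))
  simpa using this

lemma card_le_of_four_independent_free (hG : IsVertexCritical G (m + 1))
    (hfree : IsInducedFree (SimpleGraph.completeGraph (Fin 4))ᶜ G) :
    Fintype.card V ≤ 3 * (m + 1) := by
  refine card_le_of_independent_card_le hG fun s hs => ?_
  by_contra! hcard
  obtain ⟨f⟩ := Function.Embedding.nonempty_of_card_le (α := Fin 4) (β := s) (by
    simpa using Nat.succ_le_of_lt hcard)
  refine hfree ⟨⟨f.trans (Function.Embedding.subtype _), fun {i j} => ?_⟩⟩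
  have := hs (f i) (f i).2 (f j) (f j).2
  simpa using this

/-- If an independent set has more than m + 1 vertices, an m-colouring of G minus one of them, `v`,
repeats a colour on two others, `x` and `y`. A neighbour `z` of `v` with that colour would give the
edge vz with `x` and `y` isolated, so `v` can take the colour as well. -/
lemma card_le_of_coDiamond_free (hG : IsVertexCritical G (m + 1))
    (hfree : IsInducedFree
      (SimpleGraph.pathGraph 2 ⊕g (SimpleGraph.pathGraph 1 ⊕g SimpleGraph.pathGraph 1)) G) :
    Fintype.card V ≤ (m + 1) * (m + 1) := by
  classical
  refine card_le_of_independent_card_le hG fun s hs => ?_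
  by_contra! hcard
  obtain ⟨-, hnot, hdel⟩ := (isVertexCritical_succ_iff G m).1 hG
  obtain ⟨v, hv⟩ : s.Nonempty := Finset.card_pos.1 (by omega)
  obtain ⟨c, hc, hadj⟩ := hdel v
  have hc' : ∀ a, a ≠ v → c a < m := fun a ha => hc a ha
  have hadj' : ∀ a b, a ≠ v → b ≠ v → G.Adj a b → c a ≠ c b := fun a b ha hb => hadj a ha b hb
  obtain ⟨x, hx, y, hy, hxy, hcxy⟩ := Finset.exists_ne_map_eq_of_card_lt_of_maps_to
    (s := s.erase v) (t := Finset.range m) (f := c)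
    (by rw [Finset.card_erase_of_mem hv, Finset.card_range]; omega)
    (fun a ha => by simpa using hc' a (Finset.ne_of_mem_erase ha))
  rw [Finset.mem_erase] at hx hy
  have key : ∀ z, G.Adj v z → c z ≠ c x := fun z hz hcz => by
    refine hfree (coDiamond_isIndContained hz hxy (hs v hv x hx.2) (hs v hv y hy.2) ?_ ?_
      (hs x hx.2 y hy.2))
    · exact fun h => hadj' z x hz.ne' hx.1 h hcz
    · exact fun h => hadj' z y hz.ne' hy.1 h (hcz.trans hcxy)
  refine hnot ⟨fun z => if z = v then c x else c z, fun a _ => ?_, fun a _ b _ hab => ?_⟩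
  · grind
  · have := hab.ne
    have := hab.symm
    grind

/-- The private closed neighbourhoods of a maximum independent set `S` with at least three members
are pairwise anticomplete cliques, and an outside neighbour of one is complete to all of them. A
smallest one can therefore borrow the colours of another, contradicting criticality. -/
lemma independent_card_le_two_of_coPaw_free (hG : IsVertexCritical G (m + 1))
    (hfree : IsInducedFree (SimpleGraph.pathGraph 3 ⊕g SimpleGraph.pathGraph 1) G)
    (s : Finset V) (hs : ∀ a ∈ s, ∀ b ∈ s, ¬ G.Adj a b) : s.card ≤ 2 := by
  classical
  by_contra! hcard
  obtain ⟨-, hnot, hdel⟩ := (isVertexCritical_succ_iff G m).1 hG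
  obtain ⟨S, hSmem, hSmax⟩ := Finset.exists_max_image
    (Finset.univ.filter fun t : Finset V => ∀ a ∈ t, ∀ b ∈ t, ¬ G.Adj a b) Finset.card
    ⟨s, by simpa using hs⟩
  have hS : ∀ a ∈ S, ∀ b ∈ S, ¬ G.Adj a b := (Finset.mem_filter.1 hSmem).2
  have hS3 : 2 < S.card := hcard.trans_le (hSmax s (by simpa using hs))
  have hdom : ∀ v, v ∉ S → ∃ t ∈ S, G.Adj v t := by
    intro v hv
    by_contra! h
    have := hSmax (insert v S) (by
      simp only [Finset.mem_filter, Finset.mem_univ, true_and, Finset.mem_insert]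
      rintro a (rfl | ha) b (rfl | hb)
      · simp
      · exact h b hb
      · exact fun hab => h a ha hab.symm
      · exact hS a ha b hb)
    rw [Finset.card_insert_of_notMem hv] at this
    omega
  -- the private closed neighbourhoods of the members of `S`
  let K : V → Finset V := fun t =>
    Finset.univ.filter fun v => v = t ∨ (G.Adj v t ∧ ∀ r ∈ S, r ≠ t → ¬ G.Adj v r)
  have hK : ∀ t v, v ∈ K t ↔ v = t ∨ (G.Adj v t ∧ ∀ r ∈ S, r ≠ t → ¬ G.Adj v r) := by
    intro t v; simp [K]
  have hKS : ∀ t ∈ S, ∀ v ∈ K t, ∀ r ∈ S, r ≠ t → ¬ G.Adj v r := by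
    intro t ht v hv r hr hrt
    rcases (hK t v).1 hv with rfl | h
    · exact hS v ht r hr
    · exact h.2 r hr hrt
  -- The spare member of `S` serves as the isolated vertex of P₃ + P₁ below.
  have hthird : ∀ t r, ∃ q ∈ S, q ≠ t ∧ q ≠ r := by
    intro t r
    obtain ⟨q, hq, hq'⟩ := Finset.exists_mem_notMem_of_card_lt_card (s := {t, r}) (t := S)
      ((Finset.card_le_two).trans_lt hS3)
    simp only [Finset.mem_insert, Finset.mem_singleton, not_or] at hq'
    exact ⟨q, hq, hq'⟩
  have hclique : ∀ t ∈ S, ∀ v ∈ K t, ∀ w ∈ K t, v ≠ w → G.Adj v w := by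
    intro t ht v hv w hw hvw
    obtain ⟨q, hq, hqt, -⟩ := hthird t t
    by_contra hn
    rcases (hK t v).1 hv with rfl | hv'
    · rcases (hK v w).1 hw with rfl | hw'
      · exact hvw rfl
      · exact hn hw'.1.symm
    rcases (hK t w).1 hw with rfl | hw'
    · exact hn hv'.1
    exact hfree (coPaw_isIndContained hv'.1 hw'.1.symm hvw hn (hv'.2 q hq hqt) (hS t ht q hq)
      (hw'.2 q hq hqt))
  have hanti : ∀ t ∈ S, ∀ r ∈ S, t ≠ r → ∀ v ∈ K t, ∀ w ∈ K r, ¬ G.Adj v w := by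
    intro t ht r hr htr v hv w hw hvw
    rcases (hK t v).1 hv with rfl | hv'
    · exact hKS r hr w hw v ht htr hvw.symm
    obtain ⟨q, hq, hqt, hqr⟩ := hthird t r
    have htw : ¬ G.Adj t w := fun h => hKS r hr w hw t ht htr h.symm
    refine hfree (coPaw_isIndContained hv'.1.symm hvw ?_ htw (hS t ht q hq) (hv'.2 q hq hqt)
      (hKS r hr w hw q hq hqr))
    rintro rfl
    exact (hK r t).1 hw |>.elim htr fun h => hS t ht r hr h.1
  -- Such a `y` has two neighbours in `S`, or it would be private to another member and anticomplete
  -- to `K t`. Missing a member of `S` would then leave that member isolated from an induced P₃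
  -- centred at `y`. Missing `w` in `K r` would do the same, with the two ends taken in `S` away
  -- from `r`.
  have hout : ∀ t ∈ S, ∀ r ∈ S, ∀ v ∈ K t, ∀ y, y ∉ K t → G.Adj v y → ∀ w ∈ K r, G.Adj y w := by
    intro t ht r hr v hv y hy hvy w hw
    have hyS : y ∉ S := fun hyS => hanti t ht y hyS
      (by rintro rfl; exact hy ((hK t t).2 (Or.inl rfl))) v hv y ((hK y y).2 (Or.inl rfl)) hvy
    obtain ⟨p, hp, hyp⟩ := hdom y hyS
    have hpriv : ∃ q ∈ S, q ≠ p ∧ G.Adj y q := by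
      by_contra! h
      have hyK : y ∈ K p := (hK p y).2 (Or.inr ⟨hyp, h⟩)
      exact hanti t ht p hp (by rintro rfl; exact hy hyK) v hv y hyK hvy
    obtain ⟨q, hq, hqp, hyq⟩ := hpriv
    have hall : ∀ x ∈ S, G.Adj y x := by
      intro x hx
      by_contra hn
      exact hfree (coPaw_isIndContained hyp.symm hyq hqp.symm (hS p hp q hq) (hS p hp x hx) hn
        (hS q hq x hx))
    by_contra hn
    obtain ⟨x, hx, hxr, -⟩ := hthird r r
    obtain ⟨z, hz, hzr, hzx⟩ := hthird r x
    exact hfree (coPaw_isIndContained (hall x hx).symm (hall z hz) hzx.symm (hS x hx z hz)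
      (fun h => hKS r hr w hw x hx hxr h.symm) hn (fun h => hKS r hr w hw z hz hzr h.symm))
  obtain ⟨t, ht, hmin⟩ := Finset.exists_min_image S (fun t => (K t).card)
    (Finset.card_pos.1 (by omega))
  obtain ⟨r, hr, hrt, -⟩ := hthird t t
  obtain ⟨φ⟩ := Function.Embedding.nonempty_of_card_le (α := K t) (β := K r)
    (by simpa using hmin r hr)
  have htK : t ∈ K t := (hK t t).2 (Or.inl rfl)
  have htr : t ∉ K r := fun h => (hK r t).1 h |>.elim (fun h => hrt h.symm)
    fun h => hS t ht r hr h.1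
  have hφ : ∀ x : K t, (φ x : V) ≠ t := fun x hx => htr (hx ▸ (φ x).2)
  obtain ⟨c, hc, hadj⟩ := hdel t
  have hmix : ∀ a (ha : a ∈ K t) b, b ∉ K t → G.Adj a b → c (φ ⟨a, ha⟩) ≠ c b := by
    intro a ha b hb hab h
    exact hadj b (fun h => hb (h ▸ htK)) (φ ⟨a, ha⟩) (hφ _)
      (hout t ht r hr a ha b hb hab _ (φ ⟨a, ha⟩).2) h.symm
  -- Each vertex of `K t` takes the colour of its image in the clique `K r`. Outside neighbours of
  -- `K t` are complete to `K r`, so they already avoid these colours.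
  refine hnot ⟨fun x => if h : x ∈ K t then c (φ ⟨x, h⟩) else c x, fun a _ => ?_,
    fun a _ b _ hab => ?_⟩
  · by_cases ha : a ∈ K t
    · simpa [ha] using hc _ (hφ ⟨a, ha⟩)
    · simpa [ha] using hc a (fun h => ha (h ▸ htK))
  · by_cases ha : a ∈ K t <;> by_cases hb : b ∈ K t <;> simp only [ha, hb, dif_pos, dif_neg,
      not_false_eq_true]
    · refine hadj _ (hφ _) _ (hφ _) (hclique r hr _ (φ _).2 _ (φ _).2 fun h => hab.ne ?_)
      simpa using φ.injective (Subtype.ext h)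
    · exact hmix a ha b hb hab
    · exact (hmix b hb a ha hab.symm).symm
    · exact hadj a (fun h => ha (h ▸ htK)) b (fun h => hb (h ▸ htK)) hab

/-- Induction on `w`: a maximum independent set meets every clique of size w + 1 by
`not_disjoint_of_pathGraph_four_free`, so removing it as one colour class lowers the clique bound.
-/
lemma colorableOn_of_clique_card_le (hfree : IsInducedFree (SimpleGraph.pathGraph 4) G) (w : ℕ) :
    ∀ s : Finset V,
      (∀ t ⊆ s, (∀ a ∈ t, ∀ b ∈ t, a ≠ b → G.Adj a b) → t.card ≤ w) → ColorableOn G s w := by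
  classical
  induction w with
  | zero =>
    intro s hs
    have : s = ∅ := by
      by_contra h
      obtain ⟨x, hx⟩ := Finset.nonempty_of_ne_empty h
      have := hs {x} (by simpa using hx) (by simp +contextual)
      simp at this
    subst this
    exact ⟨fun _ => 0, by simp, by simp⟩
  | succ w ih =>
    intro s hs
    obtain ⟨S, hSmem, hSmax⟩ := Finset.exists_max_image
      (s.powerset.filter fun t : Finset V => ∀ a ∈ t, ∀ b ∈ t, ¬ G.Adj a b) Finset.card
      ⟨∅, by simp⟩
    simp only [Finset.mem_filter, Finset.mem_powerset] at hSmem hSmax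
    obtain ⟨hSs, hS⟩ := hSmem
    have hdom : ∀ v ∈ s, v ∉ S → ∃ t ∈ S, G.Adj v t := by
      intro v hvs hv
      by_contra! h
      have := hSmax (insert v S) ⟨Finset.insert_subset hvs hSs, by
        simp only [Finset.mem_insert]
        rintro a (rfl | ha) b (rfl | hb)
        · simp
        · exact h b hb
        · exact fun hab => h a ha hab.symm
        · exact hS a ha b hb⟩
      rw [Finset.card_insert_of_notMem hv] at this
      omega
    obtain ⟨c, hc, hadj⟩ := ih (s \ S) (by
      intro t hts ht
      by_contra! hcard
      have htS : ∀ v ∈ t, v ∈ s ∧ v ∉ S := fun v hv => Finset.mem_sdiff.1 (hts hv)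
      obtain ⟨x, hx⟩ : t.Nonempty := Finset.card_pos.1 (by omega)
      obtain ⟨y, hy, -⟩ := hdom x (htS x hx).1 (htS x hx).2
      refine not_disjoint_of_pathGraph_four_free hfree ht hS ⟨y, hy⟩ (fun v hv => ?_)
        (fun v hv => hdom v (htS v hv).1 (htS v hv).2)
      by_contra! hall
      have hvt : v ∉ t := fun h => (htS v h).2 hv
      have := hs (insert v t)
        (Finset.insert_subset (hSs hv) fun z hz => (htS z hz).1) (by
          simp only [Finset.mem_insert]
          rintro a (rfl | ha) b (rfl | hb) hab
          · exact absurd rfl hab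
          · exact hall b hb
          · exact (hall a ha).symm
          · exact ht a ha b hb hab)
      rw [Finset.card_insert_of_notMem hvt] at this
      omega)
    simp only [Finset.coe_sdiff, Set.mem_sdiff, Finset.mem_coe] at hc hadj
    refine ⟨fun x => if x ∈ S then w else c x, fun a ha => ?_, fun a ha b hb hab => ?_⟩
    · have := hc a
      grind
    · have := hc a
      have := hc b
      have := hS a
      have := hadj a
      simp only [Finset.mem_coe] at ha hb
      grind

/-- Not being m-colourable forces a clique on m + 1 vertices; a vertex outside it could be deleted
without making G m-colourable. -/
lemma card_le_of_pathGraph_four_free (hG : IsVertexCritical G (m + 1))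
    (hfree : IsInducedFree (SimpleGraph.pathGraph 4) G) : Fintype.card V ≤ m + 1 := by
  classical
  obtain ⟨-, hnot, hdel⟩ := (isVertexCritical_succ_iff G m).1 hG
  obtain ⟨t, ht, hcard⟩ : ∃ t : Finset V, (∀ a ∈ t, ∀ b ∈ t, a ≠ b → G.Adj a b) ∧ m < t.card := by
    by_contra! h
    exact hnot (by simpa using colorableOn_of_clique_card_le hfree m Finset.univ fun t _ => h t)
  obtain ⟨t', htt', hcard'⟩ := Finset.exists_subset_card_eq (Nat.succ_le_of_lt hcard)
  have huniv : ∀ v, v ∈ t' := by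
    intro v
    by_contra hv
    obtain ⟨c, hc, hadj⟩ := hdel v
    have hne : ∀ a ∈ t', a ∈ ({v}ᶜ : Set V) := fun a ha h => hv (h ▸ ha)
    obtain ⟨x, hx, y, hy, hxy, hcxy⟩ := Finset.exists_ne_map_eq_of_card_lt_of_maps_to
      (s := t') (t := Finset.range m) (f := c) (by rw [Finset.card_range]; omega)
      (fun a ha => by simpa using hc a (hne a ha))
    exact hadj x (hne x hx) y (hne y hy) (ht x (htt' hx) y (htt' hy) hxy) hcxy
  rw [← Finset.card_univ, ← hcard'.trans (Nat.succ_eq_add_one m)]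
  exact Finset.card_le_card fun v _ => huniv v

end FiniteDirection

lemma finite_criticalFreeClasses {V : Type*} {H : SimpleGraph V} (m : ℕ)
    (h : H ⊴ (SimpleGraph.completeGraph (Fin 4))ᶜ ∨
        H ⊴ SimpleGraph.pathGraph 4 ∨
        H ⊴ (SimpleGraph.pathGraph 2 ⊕g (SimpleGraph.pathGraph 1 ⊕g SimpleGraph.pathGraph 1)) ∨
        H ⊴ (SimpleGraph.pathGraph 3 ⊕g SimpleGraph.pathGraph 1)) :
    (criticalFreeClasses (m + 1) H).Finite := by
  rcases h with h | h | h | h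
  · exact finite_criticalFreeClasses_of_bound h _ fun n G hG hfree => by
      simpa using card_le_of_four_independent_free hG hfree
  · exact finite_criticalFreeClasses_of_bound h _ fun n G hG hfree => by
      simpa using card_le_of_pathGraph_four_free hG hfree
  · exact finite_criticalFreeClasses_of_bound h _ fun n G hG hfree => by
      simpa using card_le_of_coDiamond_free hG hfree
  · exact finite_criticalFreeClasses_of_bound h _ fun n G hG hfree => by
      simpa using card_le_of_independent_card_le hG
        (independent_card_le_two_of_coPaw_free hG hfree)

/-! ### A criticality criterion for graphs on the residues modulo mp + 1. -/

section Circulant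

variable {m p : ℕ}

/-- Criterion for vertex-criticality of a graph on `ℤ / (m p + 1)`: vertices at cyclic distance
less than `m` are adjacent, so independent sets have at most `p` elements, while steps by
multiples of `m` give independent sets. -/
lemma isVertexCritical_of_cyclic (hm : 1 < m) (hp : 0 < p) {G : SimpleGraph (ZMod (m * p + 1))}
    (hclose : ∀ (x : ZMod (m * p + 1)) (d : ℕ), 0 < d → d < m → G.Adj (x + d) x)
    (hstep : ∀ (x : ZMod (m * p + 1)) (j : ℕ), j < p → ¬ G.Adj (x + (m * j : ℕ)) x) :
    IsVertexCritical G (m + 1) := by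
  classical
  have hmp : m ≤ m * p := Nat.le_mul_of_pos_right m hp
  have hdel : ∀ v, ColorableOn G {v}ᶜ m := by
    intro v
    -- Positions relative to `v` run over 1, …, mp. Colouring by position minus one modulo m makes
    -- equally coloured vertices differ by mj with j < p.
    have key : ∀ a b : ZMod (m * p + 1), b ≠ v → (b - v).val ≤ (a - v).val →
        ((a - v).val - 1) % m = ((b - v).val - 1) % m → ¬ G.Adj a b := by
      intro a b hb hle hmod
      have hb0 : 0 < (b - v).val := by
        rw [Nat.pos_iff_ne_zero, Ne, ZMod.val_eq_zero, sub_eq_zero]; exact hb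
      have ha := ZMod.val_lt (a - v)
      have hval := ZMod.val_sub hle
      rw [sub_sub_sub_cancel_right] at hval
      have hdvd : m ∣ (a - v).val - (b - v).val := by
        have := (Nat.modEq_iff_dvd' (n := m) (Nat.sub_le_sub_right hle 1)).1 hmod.symm
        rwa [Nat.sub_sub_sub_cancel_right hb0] at this
      obtain ⟨j, hj⟩ := hdvd
      have hab : a = b + (m * j : ℕ) := by
        rw [← hj, ← hval, ZMod.natCast_zmod_val]; ring
      rw [hab]
      refine hstep b j (Nat.lt_of_mul_lt_mul_left (a := m) ?_)
      omega
    refine ⟨fun w => ((w - v).val - 1) % m, fun a _ => Nat.mod_lt _ (by omega), fun a ha b hb hab h => ?_⟩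
    rcases le_total (b - v).val (a - v).val with hle | hle
    · exact key a b hb hle h hab
    · exact key b a ha hle h.symm hab.symm
  refine (isVertexCritical_succ_iff G m).2 ⟨(hdel 0).univ_succ, ?_, hdel⟩
  rintro ⟨c, hc, hadj⟩
  -- The translates of a colour class by 0, …, m - 1 are disjoint, so m times its size is at most mp
  -- + 1, hence its size is at most p because m > 1.
  have hcard : ∀ i ∈ Finset.range m, (Finset.univ.filter fun x => c x = i).card ≤ p := by
    intro i _
    have hinj : Set.InjOn (fun x : ZMod (m * p + 1) × ℕ => x.1 + (x.2 : ZMod (m * p + 1)))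
        ((Finset.univ.filter fun x => c x = i) ×ˢ Finset.range m : Finset _) := by
      have key : ∀ a b : ZMod (m * p + 1), ∀ e f : ℕ, c a = c b → e ≤ f → f < m →
          a + (e : ZMod (m * p + 1)) = b + f → a = b ∧ e = f := by
        intro a b e f hab hef hf h
        have h' : a = b + ((f - e : ℕ) : ZMod (m * p + 1)) := by
          rw [Nat.cast_sub hef]; linear_combination h
        rcases Nat.eq_zero_or_pos (f - e) with h0 | h0
        · exact ⟨by simpa [h0] using h', by omega⟩
        · exact absurd hab (hadj _ trivial _ trivial (h' ▸ hclose b (f - e) h0 (by omega)))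
      rintro ⟨a, e⟩ ha ⟨b, f⟩ hb h
      simp only [Finset.coe_product, Set.mem_prod, Finset.mem_coe, Finset.mem_filter,
        Finset.mem_univ, true_and, Finset.mem_range] at ha hb
      rcases le_total e f with hef | hef
      · have := key a b e f (ha.1.trans hb.1.symm) hef hb.2 h
        rw [this.1, this.2]
      · have := key b a f e (hb.1.trans ha.1.symm) hef ha.2 h.symm
        rw [this.1, this.2]
    have h := Finset.card_le_card_of_injOn _ (fun x _ => Finset.mem_univ _) hinj
    rw [Finset.card_product, Finset.card_range, Finset.card_univ, ZMod.card, mul_comm] at h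
    by_contra! hlt
    have := Nat.mul_le_mul_left m (Nat.succ_le_of_lt hlt)
    rw [Nat.mul_succ] at this
    omega
  have := Finset.card_le_mul_card_image_of_maps_to (s := Finset.univ) (t := Finset.range m)
    (f := c) (fun a _ => Finset.mem_range.2 (hc a trivial)) p hcard
  rw [Finset.card_univ, ZMod.card, Finset.card_range, mul_comm] at this
  omega

end Circulant

/-! ### The four obstructions to finiteness. -/

section ForbiddenPatterns

variable {V W : Type*}

/-- `G` contains a triangle. -/
def HasTriangle (G : SimpleGraph V) : Prop :=
  ∃ a b c, G.Adj a b ∧ G.Adj b c ∧ G.Adj c a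

/-- `G` contains an induced cycle of length four. -/
def HasInducedSquare (G : SimpleGraph V) : Prop :=
  ∃ a b c d, G.Adj a b ∧ G.Adj b c ∧ G.Adj c d ∧ G.Adj d a ∧ a ≠ c ∧ b ≠ d ∧
    ¬ G.Adj a c ∧ ¬ G.Adj b d

/-- `G` contains an induced claw. -/
def HasInducedClaw (G : SimpleGraph V) : Prop :=
  ∃ o x y z, G.Adj o x ∧ G.Adj o y ∧ G.Adj o z ∧ x ≠ y ∧ y ≠ z ∧ x ≠ z ∧
    ¬ G.Adj x y ∧ ¬ G.Adj y z ∧ ¬ G.Adj x z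

/-- `G` contains two disjoint edges with no edge between them. -/
def HasInducedTwoEdges (G : SimpleGraph V) : Prop :=
  ∃ a b c d, G.Adj a b ∧ G.Adj c d ∧ ¬ G.Adj a c ∧ ¬ G.Adj a d ∧ ¬ G.Adj b c ∧ ¬ G.Adj b d

variable {H : SimpleGraph V} {G : SimpleGraph W}

lemma HasTriangle.isInducedFree (h : HasTriangle H) (hG : ¬ HasTriangle G) :
    IsInducedFree H G := by
  rintro ⟨f⟩
  obtain ⟨a, b, c, h⟩ := h
  exact hG ⟨f a, f b, f c, by simpa [f.map_adj_iff] using h⟩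

lemma HasInducedSquare.isInducedFree (h : HasInducedSquare H) (hG : ¬ HasInducedSquare G) :
    IsInducedFree H G := by
  rintro ⟨f⟩
  obtain ⟨a, b, c, d, h⟩ := h
  exact hG ⟨f a, f b, f c, f d, by simpa [f.map_adj_iff] using h⟩

lemma HasInducedClaw.isInducedFree (h : HasInducedClaw H) (hG : ¬ HasInducedClaw G) :
    IsInducedFree H G := by
  rintro ⟨f⟩
  obtain ⟨a, b, c, d, h⟩ := h
  exact hG ⟨f a, f b, f c, f d, by simpa [f.map_adj_iff] using h⟩

lemma HasInducedTwoEdges.isInducedFree (h : HasInducedTwoEdges H)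
    (hG : ¬ HasInducedTwoEdges G) : IsInducedFree H G := by
  rintro ⟨f⟩
  obtain ⟨a, b, c, d, h⟩ := h
  exact hG ⟨f a, f b, f c, f d, by simpa [f.map_adj_iff] using h⟩

end ForbiddenPatterns

/-! ### Powers of cycles: no induced square, no induced claw, and no triangle when m = 2. -/

section CyclePower

/-- The power of a cycle: residues modulo `n` are adjacent when they differ by a nonzero integer
of absolute value less than `m`. -/
def cyclePower (m n : ℕ) : SimpleGraph (ZMod n) where
  Adj x y := x ≠ y ∧ ∃ e : ℤ, |e| < m ∧ x - y = e
  symm := ⟨fun _ _ ⟨hne, e, he, hxy⟩ => ⟨hne.symm, -e, by rwa [abs_neg], by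
    push_cast; rw [← hxy]; ring⟩⟩
  loopless := ⟨fun _ h => h.1 rfl⟩

lemma isVertexCritical_cyclePower {m p : ℕ} (hm : 1 < m) (hp : 0 < p) :
    IsVertexCritical (cyclePower m (m * p + 1)) (m + 1) := by
  refine isVertexCritical_of_cyclic hm hp (fun x d hd hdm => ⟨?_, d, ?_, by simp⟩) ?_
  · have hmp : m ≤ m * p := Nat.le_mul_of_pos_right m hp
    rw [Ne, add_eq_left, ZMod.natCast_eq_zero_iff]
    exact Nat.not_dvd_of_pos_of_lt hd (by omega)
  · rw [abs_of_nonneg (by positivity)]; exact_mod_cast hdm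
  · rintro x j hj ⟨hne, e, he, hxe⟩
    have hdvd : ((m * p + 1 : ℕ) : ℤ) ∣ (m * j : ℤ) - e := by
      rw [← ZMod.intCast_zmod_eq_zero_iff_dvd]
      push_cast at hxe ⊢
      linear_combination hxe
    have hmj : m * j + m ≤ m * p := by
      rw [← Nat.mul_succ]; exact Nat.mul_le_mul_left m hj
    have h0 := abs_lt.1 he
    have hmj' : (m * j + m : ℤ) ≤ m * p := by exact_mod_cast hmj
    have heq : (m * j : ℤ) - e = 0 := by
      refine Int.eq_zero_of_abs_lt_dvd hdvd (abs_lt.2 ⟨?_, ?_⟩)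
      · push_cast
        have : (0 : ℤ) ≤ m * j := by positivity
        linarith
      · push_cast
        linarith
    rcases Nat.eq_zero_or_pos j with rfl | hj0
    · simp at hne
    · have : (m : ℤ) ≤ m * j := by exact_mod_cast Nat.le_mul_of_pos_right m hj0
      linarith

/-- The four signed steps have total less than 4m in absolute value, so they sum to 0 over the
integers. Nonadjacent diagonals force `e₁`, `e₂`, `e₃` to share a sign with |e₁ + e₂| ≥ m, and `e₄`
is too short to return. -/
lemma not_hasInducedSquare_cyclePower {m n : ℕ} (hn : 4 * m ≤ n) :
    ¬ HasInducedSquare (cyclePower m n) := by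
  rintro ⟨a, b, c, d, ⟨-, e₁, he₁, h₁⟩, ⟨-, e₂, he₂, h₂⟩, ⟨-, e₃, he₃, h₃⟩, ⟨-, e₄, he₄, h₄⟩,
    hac, hbd, nac, nbd⟩
  have hsum : e₁ + e₂ + e₃ + e₄ = 0 := by
    refine Int.eq_zero_of_abs_lt_dvd (m := n) ?_ ?_
    · rw [← ZMod.intCast_zmod_eq_zero_iff_dvd]
      push_cast
      rw [← h₁, ← h₂, ← h₃, ← h₄]
      ring
    · rw [abs_lt] at *
      have : (4 * m : ℤ) ≤ n := by exact_mod_cast hn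
      constructor <;> linarith [he₁.1, he₁.2]
  have hne₁ : ¬ |e₁ + e₂| < m := fun h => nac ⟨hac, _, h, by
    push_cast; rw [← h₁, ← h₂]; ring⟩
  have hne₂ : ¬ |e₂ + e₃| < m := fun h => nbd ⟨hbd, _, h, by
    push_cast; rw [← h₂, ← h₃]; ring⟩
  rw [abs_lt] at *
  omega

/-- Three integers strictly between -m and m cannot be pairwise at distance at least m. -/
lemma not_hasInducedClaw_cyclePower (m n : ℕ) : ¬ HasInducedClaw (cyclePower m n) := by
  rintro ⟨o, x, y, z, ⟨hox, e₁, he₁, h₁⟩, ⟨hoy, e₂, he₂, h₂⟩, ⟨hoz, e₃, he₃, h₃⟩, hxy, hyz, hxz,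
    nxy, nyz, nxz⟩
  have h₁₂ : ¬ |e₂ - e₁| < m := fun h => nxy ⟨hxy, _, h, by
    push_cast; rw [← h₁, ← h₂]; ring⟩
  have h₂₃ : ¬ |e₃ - e₂| < m := fun h => nyz ⟨hyz, _, h, by
    push_cast; rw [← h₂, ← h₃]; ring⟩
  have h₁₃ : ¬ |e₃ - e₁| < m := fun h => nxz ⟨hxz, _, h, by
    push_cast; rw [← h₁, ← h₃]; ring⟩
  rw [abs_lt] at *
  omega

/-- Three steps ±1 have an odd sum of absolute value at most 3, which is not a multiple of n > 3. -/
lemma not_hasTriangle_cyclePower {n : ℕ} (hn : 3 < n) : ¬ HasTriangle (cyclePower 2 n) := by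
  rintro ⟨a, b, c, ⟨hab, e₁, he₁, h₁⟩, ⟨hbc, e₂, he₂, h₂⟩, ⟨hca, e₃, he₃, h₃⟩⟩
  have hsum : e₁ + e₂ + e₃ = 0 := by
    refine Int.eq_zero_of_abs_lt_dvd (m := n) ?_ ?_
    · rw [← ZMod.intCast_zmod_eq_zero_iff_dvd]
      push_cast
      rw [← h₁, ← h₂, ← h₃]
      ring
    · rw [abs_lt] at *
      push_cast at *
      omega
  have hne : ∀ {x y : ZMod n} {e : ℤ}, x ≠ y → x - y = e → e ≠ 0 := by
    rintro x y e hxy h rfl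
    exact hxy (sub_eq_zero.1 (by simpa using h))
  have := hne hab h₁
  have := hne hbc h₂
  have := hne hca h₃
  rw [abs_lt] at *
  push_cast at *
  omega

end CyclePower

/-! ### A 2P₂-free critical circulant. -/

section TwoEdgesFree

/-- The distances joined in `twoEdgesFreeGraph`. -/
def TwoEdgesFreeDist (m p d : ℕ) : Prop :=
  d ≠ 0 ∧ (d = 1 ∨ d = m * p ∨ ((d : ZMod m) ≠ 0 ∧ (d : ZMod m) ≠ 1))

/-- Modulo m the reflection is d ↦ 1 - d, which swaps the residues 0 and 1; it also swaps the
exceptional distances 1 and mp. -/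
lemma TwoEdgesFreeDist.symm {m p d : ℕ} (hd : d < m * p + 1) (h : TwoEdgesFreeDist m p d) :
    TwoEdgesFreeDist m p (m * p + 1 - d) := by
  obtain ⟨h0, h⟩ := h
  refine ⟨by omega, ?_⟩
  rcases h with h | h | h
  · right; left; omega
  · left; omega
  · right; right
    rw [Nat.cast_sub hd.le]
    push_cast
    simp only [CharP.cast_eq_zero, zero_mul, zero_add]
    exact ⟨fun h' => h.2 (by linear_combination -h'), fun h' => h.1 (by linear_combination -h')⟩

/-- The circulant graph on the residues modulo `m p + 1` in which the nonadjacent residues are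
those whose difference is congruent to `0` or `1` modulo `m`, except for successive residues. -/
def twoEdgesFreeGraph (m p : ℕ) : SimpleGraph (ZMod (m * p + 1)) where
  Adj x y := TwoEdgesFreeDist m p (x - y).val
  symm := ⟨fun x y h => by
    have hne : x - y ≠ 0 := fun h0 => h.1 (by rw [h0, ZMod.val_zero])
    rw [← neg_sub, ZMod.neg_val, if_neg hne]
    exact h.symm (ZMod.val_lt _)⟩
  loopless := ⟨fun x h => h.1 (by simp)⟩

lemma natCast_ne_zero_of_lt {m d : ℕ} (hd : 0 < d) (hdm : d < m) : (d : ZMod m) ≠ 0 := by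
  rw [Ne, ZMod.natCast_eq_zero_iff]
  exact Nat.not_dvd_of_pos_of_lt hd hdm

lemma isVertexCritical_twoEdgesFreeGraph {m p : ℕ} (hm : 3 < m) (hp : 0 < p) :
    IsVertexCritical (twoEdgesFreeGraph m p) (m + 1) := by
  have hmp : m ≤ m * p := Nat.le_mul_of_pos_right m hp
  refine isVertexCritical_of_cyclic (by omega) hp (fun x d hd hdm => ?_) (fun x j hj h => ?_)
  · change TwoEdgesFreeDist m p _
    rw [add_sub_cancel_left, ZMod.val_cast_of_lt (by omega)]
    refine ⟨by omega, or_iff_not_imp_left.2 fun h1 => Or.inr ⟨natCast_ne_zero_of_lt hd hdm, ?_⟩⟩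
    have := natCast_ne_zero_of_lt (m := m) (d := d - 1) (by omega) (by omega)
    rwa [Nat.cast_sub hd, Nat.cast_one, sub_ne_zero] at this
  · change TwoEdgesFreeDist m p _ at h
    have hlt : m * j < m * p := (Nat.mul_lt_mul_left (by omega)).2 hj
    rw [add_sub_cancel_left, ZMod.val_cast_of_lt (by omega)] at h
    obtain ⟨-, h | h | h⟩ := h
    · have := Nat.dvd_one.1 ⟨j, h.symm⟩
      omega
    · omega
    · simp at h

lemma not_hasInducedTwoEdges_twoEdgesFreeGraph {m p : ℕ} (hm : 3 < m) :
    ¬ HasInducedTwoEdges (twoEdgesFreeGraph m p) := by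
  have n1 : (1 : ZMod m) ≠ 0 := by
    simpa using natCast_ne_zero_of_lt (m := m) (d := 1) (by omega) (by omega)
  have n2 : (2 : ZMod m) ≠ 0 := by
    simpa using natCast_ne_zero_of_lt (m := m) (d := 2) (by omega) (by omega)
  have n3 : (3 : ZMod m) ≠ 0 := by
    simpa using natCast_ne_zero_of_lt (m := m) (d := 3) (by omega) (by omega)
  have hadj : ∀ a x y : ZMod (m * p + 1), (y - a).val ≤ (x - a).val →
      ((twoEdgesFreeGraph m p).Adj x y ↔ TwoEdgesFreeDist m p ((x - a).val - (y - a).val)) := by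
    intro a x y hle
    rw [← ZMod.val_sub hle, sub_sub_sub_cancel_right]
    rfl
  -- Rotate `a` to position 0 and order the second edge so that `b` precedes `d`; only positions and
  -- their residues modulo m then matter.
  have key : ∀ a c b d : ZMod (m * p + 1), (b - a).val ≤ (d - a).val →
      (twoEdgesFreeGraph m p).Adj a c → (twoEdgesFreeGraph m p).Adj b d →
      ¬ (twoEdgesFreeGraph m p).Adj a b → ¬ (twoEdgesFreeGraph m p).Adj a d →
      ¬ (twoEdgesFreeGraph m p).Adj c b → ¬ (twoEdgesFreeGraph m p).Adj c d → False := by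
    intro a c b d hle hac hbd nab nad ncb ncd
    have hba : b ≠ a := by rintro rfl; exact nad hbd
    have hda : d ≠ a := by rintro rfl; exact nab hbd.symm
    have hbc : b ≠ c := by rintro rfl; exact ncd hbd
    have hdc : d ≠ c := by rintro rfl; exact ncb hbd.symm
    have hval : ∀ {x y : ZMod (m * p + 1)}, x ≠ y → (x - a).val ≠ (y - a).val :=
      fun hxy h => hxy (sub_left_injective (ZMod.val_injective _ h))
    have hb0 := hval hba
    have hd0 := hval hda
    have hbc0 := hval hbc
    have hdc0 := hval hdc
    have hbn := ZMod.val_lt (b - a)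
    have hdn := ZMod.val_lt (d - a)
    have hcn := ZMod.val_lt (c - a)
    have hz : (a - a).val = 0 := by simp
    rw [SimpleGraph.adj_comm, hadj a c a (by simp), hz] at hac
    rw [SimpleGraph.adj_comm, hadj a d b hle] at hbd
    rw [SimpleGraph.adj_comm, hadj a b a (by simp), hz] at nab
    rw [SimpleGraph.adj_comm, hadj a d a (by simp), hz] at nad
    have hcb : (b - a).val ≤ (c - a).val ∧ ¬ TwoEdgesFreeDist m p ((c - a).val - (b - a).val) ∨
        (c - a).val ≤ (b - a).val ∧ ¬ TwoEdgesFreeDist m p ((b - a).val - (c - a).val) := by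
      rcases le_total (b - a).val (c - a).val with h | h
      · exact Or.inl ⟨h, by rwa [← hadj a c b h]⟩
      · exact Or.inr ⟨h, by rwa [← hadj a b c h, SimpleGraph.adj_comm]⟩
    have hcd : (d - a).val ≤ (c - a).val ∧ ¬ TwoEdgesFreeDist m p ((c - a).val - (d - a).val) ∨
        (c - a).val ≤ (d - a).val ∧ ¬ TwoEdgesFreeDist m p ((d - a).val - (c - a).val) := by
      rcases le_total (d - a).val (c - a).val with h | h
      · exact Or.inl ⟨h, by rwa [← hadj a c d h]⟩
      · exact Or.inr ⟨h, by rwa [← hadj a d c h, SimpleGraph.adj_comm]⟩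
    rw [hz] at hb0 hd0
    generalize (b - a).val = β at *
    generalize (c - a).val = γ at *
    generalize (d - a).val = δ at *
    -- residues modulo `m` of the distances
    have hnot : ∀ {x y : ℕ}, y ≤ x → x ≠ y → ¬ TwoEdgesFreeDist m p (x - y) →
        ((x : ZMod m) - y = 0 ∨ (x : ZMod m) - y = 1) ∧ x ≠ y + 1 ∧ x ≠ y + m * p := by
      intro x y hyx hxy h
      unfold TwoEdgesFreeDist at h
      rw [Nat.cast_sub hyx] at h
      push Not at h
      have h' := h (by omega)
      refine ⟨?_, by omega, by omega⟩
      by_contra! h3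
      exact h3.2 (h'.2.2 h3.1)
    have hβ := hnot (Nat.zero_le β) hb0 nab
    have hδ := hnot (Nat.zero_le δ) hd0 nad
    have hγ : ((γ : ZMod m) ≠ 0 ∧ (γ : ZMod m) ≠ 1) ∨ ((γ : ZMod m) = 1 ∧ γ = 1) ∨
        ((γ : ZMod m) = 0 ∧ γ = m * p) := by
      obtain ⟨-, h | h | h⟩ := hac
      · rw [Nat.sub_zero] at h
        exact Or.inr (Or.inl ⟨by simp [h], h⟩)
      · rw [Nat.sub_zero] at h
        exact Or.inr (Or.inr ⟨by simp [h], h⟩)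
      · exact Or.inl h
    have hβδ : β < δ ∧ ((δ : ZMod m) = β + 1 ∨
        ((δ : ZMod m) - β ≠ 0 ∧ (δ : ZMod m) - β ≠ 1)) := by
      obtain ⟨h0, h | h | h⟩ := hbd
      · obtain rfl : δ = β + 1 := by omega
        exact ⟨by omega, Or.inl (by push_cast; rfl)⟩
      · omega
      · rw [Nat.cast_sub hle] at h
        exact ⟨by omega, Or.inr h⟩
    have hβγ : (β < γ ∧ ((γ : ZMod m) - β = 0 ∨ (γ : ZMod m) - β = 1)) ∨
        (γ < β ∧ ((β : ZMod m) - γ = 0 ∨ (β : ZMod m) - γ = 1)) :=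
      hcb.imp (fun h => ⟨by omega, (hnot h.1 hbc0.symm h.2).1⟩)
        (fun h => ⟨by omega, (hnot h.1 hbc0 h.2).1⟩)
    have hδγ : (δ < γ ∧ ((γ : ZMod m) - δ = 0 ∨ (γ : ZMod m) - δ = 1)) ∨
        (γ < δ ∧ ((δ : ZMod m) - γ = 0 ∨ (δ : ZMod m) - γ = 1)) :=
      hcd.imp (fun h => ⟨by omega, (hnot h.1 hdc0.symm h.2).1⟩)
        (fun h => ⟨by omega, (hnot h.1 hdc0 h.2).1⟩)
    have hB := hβ.1
    have hD := hδ.1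
    rw [Nat.cast_zero, sub_zero] at hB hD
    clear hcb hcd hnot hβ hδ hac hbd nab nad hadj hz hval hba hda hbc hdc ncb ncd a b c d
    generalize (β : ZMod m) = B at *
    generalize (γ : ZMod m) = C at *
    generalize (δ : ZMod m) = D at *
    generalize m * p = q at *
    -- Nonadjacency to `a` puts B and D in {0, 1}, and the edge bd makes them different. In each
    -- order of β, γ, δ the conditions on C either force C to be 0 or 1, so that γ is the extreme
    -- position mp or 1, which the order excludes, or require 1, 2 or 3 to vanish modulo m. The case
    -- C = 2 = -1, with B = 1, D = 0 and γ in between, is what requires m > 3.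
    rcases hB with rfl | rfl <;> rcases hD with rfl | rfl <;> grind
  rintro ⟨a, c, b, d, hac, hbd, nab, nad, ncb, ncd⟩
  rcases le_total (b - a).val (d - a).val with h | h
  · exact key a c b d h hac hbd nab nad ncb ncd
  · exact key a c d b h hac hbd.symm nad nab ncd ncb

end TwoEdgesFree

/-! ### Large triangle-free critical graphs. -/

section Mycielskian

variable {V : Type*}

/-- The Mycielskian of a graph: `some (inl v)` are the original vertices, `some (inr v)` their
copies, and `none` is the vertex joined to all the copies. -/
def mycielskian (G : SimpleGraph V) : SimpleGraph (Option (V ⊕ V)) where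
  Adj
    | some (.inl a), some (.inl b) => G.Adj a b
    | some (.inl a), some (.inr b) => G.Adj a b
    | some (.inr a), some (.inl b) => G.Adj a b
    | some (.inr _), none => True
    | none, some (.inr _) => True
    | _, _ => False
  symm := ⟨by
    rintro (_ | a | a) (_ | b | b) h
    all_goals first | exact h | exact G.adj_symm h⟩
  loopless := ⟨by
    rintro (_ | a | a) h
    exacts [h, G.loopless.irrefl a h, h]⟩

variable {G : SimpleGraph V} {a b : V}

@[simp] lemma mycielskian_adj_inl_inl :
    (mycielskian G).Adj (some (.inl a)) (some (.inl b)) ↔ G.Adj a b := Iff.rfl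

@[simp] lemma mycielskian_adj_inl_inr :
    (mycielskian G).Adj (some (.inl a)) (some (.inr b)) ↔ G.Adj a b := Iff.rfl

@[simp] lemma mycielskian_adj_inr_inl :
    (mycielskian G).Adj (some (.inr a)) (some (.inl b)) ↔ G.Adj a b := Iff.rfl

@[simp] lemma mycielskian_adj_inr_inr :
    ¬ (mycielskian G).Adj (some (.inr a)) (some (.inr b)) := id

@[simp] lemma mycielskian_adj_inl_none : ¬ (mycielskian G).Adj (some (.inl a)) none := id

@[simp] lemma mycielskian_adj_none_inl : ¬ (mycielskian G).Adj none (some (.inl a)) := id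

@[simp] lemma mycielskian_adj_inr_none : (mycielskian G).Adj (some (.inr a)) none := trivial

@[simp] lemma mycielskian_adj_none_inr : (mycielskian G).Adj none (some (.inr a)) := trivial

lemma not_hasTriangle_mycielskian (hG : ¬ HasTriangle G) : ¬ HasTriangle (mycielskian G) := by
  rintro ⟨_ | x | x, _ | y | y, _ | z | z, h₁, h₂, h₃⟩ <;> simp at h₁ h₂ h₃ <;>
    exact hG ⟨x, y, z, h₁, h₂, h₃⟩

lemma colorableOn_of_mycielskian {m : ℕ}
    (h : ColorableOn (mycielskian G) Set.univ (m + 1)) : ColorableOn G Set.univ m := by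
  obtain ⟨c, hc, hadj⟩ := h
  have hapex : ∀ v, c (some (.inr v)) ≠ c none := fun v => hadj _ trivial _ trivial (by simp)
  -- colour `v` without the colour of the apex, using its copy where necessary
  let g : V → ℕ := fun v => if c (some (.inl v)) = c none then c (some (.inr v))
    else c (some (.inl v))
  have hg : ∀ v, g v = if c (some (.inl v)) = c none then c (some (.inr v))
    else c (some (.inl v)) := fun v => rfl
  have hlt : ∀ x, c x < m + 1 := fun x => hc x trivial
  have hga : ∀ v, g v ≠ c none := by
    intro v
    have := hapex v
    grind
  have hgm : ∀ v, g v < m + 1 := by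
    intro v
    rw [hg]
    split_ifs <;> exact hlt _
  have hgadj : ∀ u v, G.Adj u v → g u ≠ g v := by
    intro u v huv
    have h₁ : c (some (.inl u)) ≠ c (some (.inl v)) := hadj _ trivial _ trivial (by simpa using huv)
    have h₂ : c (some (.inr u)) ≠ c (some (.inl v)) := hadj _ trivial _ trivial (by simpa using huv)
    have h₃ : c (some (.inl u)) ≠ c (some (.inr v)) := hadj _ trivial _ trivial (by simpa using huv)
    grind
  have hapexlt := hlt none
  -- `g` never uses the apex colour, so renaming `m` to that colour leaves only colours below `m`.
  refine ⟨fun v => if g v = m then c none else g v, fun v _ => ?_, fun u _ v _ huv => ?_⟩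
  · have := hga v
    have := hgm v
    grind
  · have := hga u
    have := hga v
    have := hgadj u v huv
    grind

lemma IsVertexCritical.mycielskian {m : ℕ} (hm : 0 < m) (hG : IsVertexCritical G (m + 1)) :
    IsVertexCritical (mycielskian G) (m + 2) := by
  classical
  obtain ⟨⟨c, hc, hadj⟩, hnot, hdel⟩ := (isVertexCritical_succ_iff G m).1 hG
  have hdel' : ∀ x, ColorableOn (_root_.mycielskian G) {x}ᶜ (m + 1) := by
    rintro (_ | v | v)
    -- Without the apex, each copy repeats the colour of its original; the apex value 0 is a dummy.
    · refine ⟨fun x => x.elim 0 (Sum.elim c c), ?_, ?_⟩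
      · rintro (_ | a | a) ha
        · simp at ha
        · exact hc a trivial
        · exact hc a trivial
      · rintro (_ | a | a) ha (_ | b | b) hb hab <;> simp at ha hb hab <;>
          exact hadj a trivial b trivial hab
    · obtain ⟨c, hc, hadj⟩ := hdel v
      -- Without an original vertex, all copies share the new colour `m`; the apex takes 0, which
      -- differs from `m` since m > 0.
      refine ⟨fun x => x.elim 0 (Sum.elim c fun _ => m), ?_, ?_⟩
      · rintro (_ | a | a) ha
        · simp
        · have := hc a (by simpa using ha)
          simp only [Option.elim_some, Sum.elim_inl]
          omega
        · simp
      · rintro (_ | a | a) ha (_ | b | b) hb hab <;> simp at ha hb hab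
        · simpa using hm.ne
        · exact hadj a ha b hb hab
        · simpa using (hc a ha).ne
        · simpa using hm.ne'
        · simpa using (hc b hb).ne'
    · obtain ⟨c, hc, hadj⟩ := hdel v
      have hc' : ∀ a, a ≠ v → c a < m := fun a ha => hc a ha
      have hadj' : ∀ a b, a ≠ v → b ≠ v → G.Adj a b → c a ≠ c b :=
        fun a b ha hb => hadj a ha b hb
      -- Without the copy of `v`, both `v` and the apex, which are nonadjacent, take the new colour
      -- `m`.
      refine ⟨fun x => x.elim m (Sum.elim (fun a => if a = v then m else c a) c), ?_, ?_⟩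
      · rintro (_ | a | a) ha
        · simp
        · have := hc' a
          simp only [Option.elim_some, Sum.elim_inl]
          grind
        · have := hc' a (by simpa using ha)
          simp only [Option.elim_some, Sum.elim_inr]
          omega
      · rintro (_ | a | a) ha (_ | b | b) hb hab <;> simp at ha hb hab <;>
          simp only [Option.elim_some, Option.elim_none, Sum.elim_inl, Sum.elim_inr]
        · exact (hc' b hb).ne'
        · have := hab.ne
          have := hc' a
          have := hc' b
          have := hadj' a b
          grind
        · have := hc' b hb
          have := hadj' a b
          grind
        · exact (hc' a ha).ne
        · have := hc' a ha
          have := hadj' a b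
          grind
  exact (isVertexCritical_succ_iff _ (m + 1)).2
    ⟨(hdel' none).univ_succ, fun h => hnot (colorableOn_of_mycielskian h), hdel'⟩

end Mycielskian

lemma exists_triangleFree_vertexCritical (m : ℕ) (hm : 2 ≤ m) (N : ℕ) :
    ∃ (V : Type) (_ : Fintype V) (G : SimpleGraph V),
      N < Fintype.card V ∧ IsVertexCritical G (m + 1) ∧ ¬ HasTriangle G := by
  induction m, hm using Nat.le_induction with
  | base =>
    refine ⟨ZMod (2 * (N + 2) + 1), inferInstance, cyclePower 2 _, ?_,
      isVertexCritical_cyclePower (by omega) (by omega), not_hasTriangle_cyclePower (by omega)⟩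
    rw [ZMod.card]
    omega
  | succ m hm ih =>
    obtain ⟨V, _, G, hN, hG, hT⟩ := ih
    refine ⟨Option (V ⊕ V), inferInstance, mycielskian G, ?_, hG.mycielskian (by omega),
      not_hasTriangle_mycielskian hT⟩
    rw [Fintype.card_option, Fintype.card_sum]
    omega

/-! ### Graphs on at most four vertices. -/

section Classification

/-- The adjacency table of the graph on four vertices with the given pairs as edges. -/
def fourVertexTable (p q r s t u : Bool) : Fin 4 → Fin 4 → Bool :=
  ![![false, p, q, r], ![p, false, s, t], ![q, s, false, u], ![r, t, u, false]]

/-- One of the eight induced patterns of a graph on four vertices occurs: triangle, square, claw,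
`2P₂`, `4P₁`, `P₄`, `P₂ + 2P₁`, `P₃ + P₁`. -/
def HasFourVertexPattern (A : Fin 4 → Fin 4 → Prop) : Prop :=
  (∃ a b, A a b ∧ ∃ c, A b c ∧ A c a) ∨
  (∃ a b, A a b ∧ ∃ c, A b c ∧ ∃ d, A c d ∧ A d a ∧ a ≠ c ∧ b ≠ d ∧ ¬ A a c ∧ ¬ A b d) ∨
  (∃ a b, A a b ∧ ∃ c, A a c ∧ ∃ d, A a d ∧ b ≠ c ∧ c ≠ d ∧ b ≠ d ∧
    ¬ A b c ∧ ¬ A c d ∧ ¬ A b d) ∨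
  (∃ a b, A a b ∧ ∃ c d, A c d ∧ ¬ A a c ∧ ¬ A a d ∧ ¬ A b c ∧ ¬ A b d) ∨
  (∀ a b, ¬ A a b) ∨
  (∃ a b, A a b ∧ ∃ c, A b c ∧ ∃ d, A c d ∧ ¬ A a c ∧ ¬ A a d ∧ ¬ A b d) ∨
  (∃ a b, A a b ∧ ∃ c d, c ≠ d ∧ ¬ A a c ∧ ¬ A a d ∧ ¬ A b c ∧ ¬ A b d ∧ ¬ A c d) ∨
  (∃ a b, A a b ∧ ∃ c, A b c ∧ a ≠ c ∧ ¬ A a c ∧ ∃ d, ¬ A a d ∧ ¬ A b d ∧ ¬ A c d)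

set_option synthInstance.maxHeartbeats 200000 in
set_option synthInstance.maxSize 2000 in
instance (A : Fin 4 → Fin 4 → Prop) [∀ i j, Decidable (A i j)] :
    Decidable (HasFourVertexPattern A) := by
  unfold HasFourVertexPattern
  infer_instance

set_option maxRecDepth 10000 in
lemma hasFourVertexPattern_table : ∀ p q r s t u : Bool,
    HasFourVertexPattern fun i j => fourVertexTable p q r s t u i j = true := by
  decide

/-- An induced embedding between graphs of equal order is an isomorphism. -/
lemma isIndContained_of_card_eq {V W : Type*} [Fintype V] [Fintype W] {T : SimpleGraph V}
    {H : SimpleGraph W} (h : T ⊴ H) (hcard : Fintype.card V = Fintype.card W) : H ⊴ T := by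
  obtain ⟨f⟩ := h
  have hbij : Function.Bijective f :=
    (Fintype.bijective_iff_injective_and_card f).2 ⟨f.injective, hcard⟩
  exact ⟨(RelIso.ofSurjective f hbij.surjective).symm.toRelEmbedding⟩

lemma classification_four (H : SimpleGraph (Fin 4)) :
    HasTriangle H ∨ HasInducedSquare H ∨ HasInducedClaw H ∨ HasInducedTwoEdges H ∨
      H ⊴ (SimpleGraph.completeGraph (Fin 4))ᶜ ∨ H ⊴ SimpleGraph.pathGraph 4 ∨
      H ⊴ (SimpleGraph.pathGraph 2 ⊕g (SimpleGraph.pathGraph 1 ⊕g SimpleGraph.pathGraph 1)) ∨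
      H ⊴ (SimpleGraph.pathGraph 3 ⊕g SimpleGraph.pathGraph 1) := by
  classical
  have hA : (fun i j => fourVertexTable (H.Adj 0 1) (H.Adj 0 2) (H.Adj 0 3) (H.Adj 1 2)
      (H.Adj 1 3) (H.Adj 2 3) i j = true) = H.Adj := by
    ext i j
    fin_cases i <;> fin_cases j <;> simp [fourVertexTable] <;> exact H.adj_comm _ _
  have h := hasFourVertexPattern_table (H.Adj 0 1) (H.Adj 0 2) (H.Adj 0 3) (H.Adj 1 2)
    (H.Adj 1 3) (H.Adj 2 3)
  rw [hA] at h
  rcases h with ⟨a, b, h₁, c, h₂, h₃⟩ | ⟨a, b, h₁, c, h₂, d, h⟩ | ⟨a, b, h₁, c, h₂, d, h⟩ |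
    ⟨a, b, h₁, c, d, h⟩ | h | ⟨a, b, h₁, c, h₂, d, h₃, h₄, h₅, h₆⟩ |
    ⟨a, b, h₁, c, d, h₂, h₃, h₄, h₅, h₆, h₇⟩ | ⟨a, b, h₁, c, h₂, h₃, h₄, d, h₅, h₆, h₇⟩
  · exact Or.inl ⟨a, b, c, h₁, h₂, h₃⟩
  · exact Or.inr <| Or.inl ⟨a, b, c, d, h₁, h₂, h⟩
  · exact Or.inr <| Or.inr <| Or.inl ⟨a, b, c, d, h₁, h₂, h⟩
  · exact Or.inr <| Or.inr <| Or.inr <| Or.inl ⟨a, b, c, d, h₁, h⟩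
  · refine Or.inr <| Or.inr <| Or.inr <| Or.inr <| Or.inl
      ⟨⟨Function.Embedding.refl _, fun {i j} => ?_⟩⟩
    simpa using h i j
  · exact Or.inr <| Or.inr <| Or.inr <| Or.inr <| Or.inr <| Or.inl <|
      isIndContained_of_card_eq (pathGraph_four_isIndContained h₁ h₂ h₃ h₄ h₅ h₆) rfl
  · exact Or.inr <| Or.inr <| Or.inr <| Or.inr <| Or.inr <| Or.inr <| Or.inl <|
      isIndContained_of_card_eq (coDiamond_isIndContained h₁ h₂ h₃ h₄ h₅ h₆ h₇) rfl
  · exact Or.inr <| Or.inr <| Or.inr <| Or.inr <| Or.inr <| Or.inr <| Or.inr <|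
      isIndContained_of_card_eq (coPaw_isIndContained h₁ h₂ h₃ h₄ h₅ h₆ h₇) rfl

/-- A graph with at most four vertices contains a triangle, an induced square, an induced claw or
an induced `2P₂`, or else is an induced subgraph of `4P₁`, `P₄`, `P₂ + 2P₁` or `P₃ + P₁`. -/
lemma classification_card_le_four {V : Type*} [Finite V] (H : SimpleGraph V)
    (hH : Nat.card V ≤ 4) :
    HasTriangle H ∨ HasInducedSquare H ∨ HasInducedClaw H ∨ HasInducedTwoEdges H ∨
      H ⊴ (SimpleGraph.completeGraph (Fin 4))ᶜ ∨ H ⊴ SimpleGraph.pathGraph 4 ∨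
      H ⊴ (SimpleGraph.pathGraph 2 ⊕g (SimpleGraph.pathGraph 1 ⊕g SimpleGraph.pathGraph 1)) ∨
      H ⊴ (SimpleGraph.pathGraph 3 ⊕g SimpleGraph.pathGraph 1) := by
  have := Fintype.ofFinite V
  obtain ⟨f⟩ := Function.Embedding.nonempty_of_card_le (α := V) (β := Fin 4)
    (by simpa [Nat.card_eq_fintype_card] using hH)
  have hadj : ∀ u v, (H.map f).Adj (f u) (f v) ↔ H.Adj u v := fun u v => by simp
  have hrange : ∀ {x y}, (H.map f).Adj x y → ∃ u, f u = x := by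
    intro x y h
    obtain ⟨u, v, -, rfl, -⟩ := (SimpleGraph.map_adj f H x y).1 h
    exact ⟨u, rfl⟩
  have hH' : H ⊴ H.map f := ⟨⟨f, fun {u v} => hadj u v⟩⟩
  -- `H.map f` is `H` padded with isolated vertices. The first four patterns have no isolated
  -- vertex, so they already lie in `H`.
  rcases classification_four (H.map f) with ⟨a, b, c, h⟩ | ⟨a, b, c, d, h⟩ | ⟨a, b, c, d, h⟩ |
    ⟨a, b, c, d, h⟩ | h | h | h | h
  · obtain ⟨a, rfl⟩ := hrange h.1
    obtain ⟨b, rfl⟩ := hrange h.2.1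
    obtain ⟨c, rfl⟩ := hrange h.2.2
    simp only [hadj] at h
    exact Or.inl ⟨a, b, c, h⟩
  · obtain ⟨a, rfl⟩ := hrange h.1
    obtain ⟨b, rfl⟩ := hrange h.2.1
    obtain ⟨c, rfl⟩ := hrange h.2.2.1
    obtain ⟨d, rfl⟩ := hrange h.2.2.2.1
    simp only [hadj, f.injective.ne_iff] at h
    exact Or.inr <| Or.inl ⟨a, b, c, d, h⟩
  · obtain ⟨a, rfl⟩ := hrange h.1
    obtain ⟨b, rfl⟩ := hrange h.1.symm
    obtain ⟨c, rfl⟩ := hrange h.2.1.symm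
    obtain ⟨d, rfl⟩ := hrange h.2.2.1.symm
    simp only [hadj, f.injective.ne_iff] at h
    exact Or.inr <| Or.inr <| Or.inl ⟨a, b, c, d, h⟩
  · obtain ⟨a, rfl⟩ := hrange h.1
    obtain ⟨b, rfl⟩ := hrange h.1.symm
    obtain ⟨c, rfl⟩ := hrange h.2.1
    obtain ⟨d, rfl⟩ := hrange h.2.1.symm
    simp only [hadj] at h
    exact Or.inr <| Or.inr <| Or.inr <| Or.inl ⟨a, b, c, d, h⟩
  · exact Or.inr <| Or.inr <| Or.inr <| Or.inr <| Or.inl (hH'.trans h)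
  · exact Or.inr <| Or.inr <| Or.inr <| Or.inr <| Or.inr <| Or.inl (hH'.trans h)
  · exact Or.inr <| Or.inr <| Or.inr <| Or.inr <| Or.inr <| Or.inr <| Or.inl (hH'.trans h)
  · exact Or.inr <| Or.inr <| Or.inr <| Or.inr <| Or.inr <| Or.inr <| Or.inr (hH'.trans h)

end Classification

theorem theorem1 {V : Type*} [Finite V] (H : SimpleGraph V) (hH : Nat.card V ≤ 4)
    (k : ℕ) (hk : 5 ≤ k) :
    (criticalFreeClasses k H).Finite ↔
      (H ⊴ (SimpleGraph.completeGraph (Fin 4))ᶜ ∨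
        H ⊴ SimpleGraph.pathGraph 4 ∨
        H ⊴ (SimpleGraph.pathGraph 2 ⊕g (SimpleGraph.pathGraph 1 ⊕g SimpleGraph.pathGraph 1)) ∨
        H ⊴ (SimpleGraph.pathGraph 3 ⊕g SimpleGraph.pathGraph 1)) := by
  obtain ⟨m, rfl⟩ : ∃ m, k = m + 1 := ⟨k - 1, by omega⟩
  refine ⟨fun hfin => ?_, finite_criticalFreeClasses m⟩
  -- With p = N + 4 the order exceeds N, and p ≥ 4 gives the bound 4m ≤ mp + 1 needed to exclude
  -- squares.
  have hlarge : ∀ N, N < Fintype.card (ZMod (m * (N + 4) + 1)) := by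
    intro N
    rw [ZMod.card]
    have := Nat.le_mul_of_pos_left (N + 4) (show 0 < m by omega)
    omega
  rcases classification_card_le_four H hH with h | h | h | h | h
  · refine absurd hfin (criticalFreeClasses_infinite fun N => ?_)
    obtain ⟨V, hV, G, hN, hG, hT⟩ := exists_triangleFree_vertexCritical m (by omega) N
    exact ⟨V, hV, G, hN, hG, h.isInducedFree hT⟩
  · exact absurd hfin (criticalFreeClasses_infinite fun N =>
      ⟨_, inferInstance, cyclePower m (m * (N + 4) + 1), hlarge N,
        isVertexCritical_cyclePower (by omega) (by omega),
        h.isInducedFree (not_hasInducedSquare_cyclePower (by nlinarith))⟩)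
  · exact absurd hfin (criticalFreeClasses_infinite fun N =>
      ⟨_, inferInstance, cyclePower m (m * (N + 4) + 1), hlarge N,
        isVertexCritical_cyclePower (by omega) (by omega),
        h.isInducedFree (not_hasInducedClaw_cyclePower m _)⟩)
  · exact absurd hfin (criticalFreeClasses_infinite fun N =>
      ⟨_, inferInstance, twoEdgesFreeGraph m (N + 4), hlarge N,
        isVertexCritical_twoEdgesFreeGraph (by omega) (by omega),
        h.isInducedFree (not_hasInducedTwoEdges_twoEdgesFreeGraph (by omega))⟩)
  · exact h
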